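/- Let $n\ge 1$, let $\Omega\subset\mathbb{C}^n$ be a bounded open set (in particular, any bounded domain), and let $f:\Omega\to(0,\infty)$ be continuous. For a real-valued $C^2$ function $\varphi$ let $D^2_{\mathbb{C}}\varphi=\left(\frac{\partial^2\varphi}{\partial z_j\partial\bar z_k}\right)_{1\le j,k\le n}$ be its complex Hessian, and for a Hermitian matrix $A$ let $\Lambda_1(A)$ be its smallest eigenvalue. Consider the equation $$\Lambda_1(D^2_{\mathbb{C}}u)=f\quad\text{in }\Omega.\qquad(*)$$ An upper semicontinuous function $u:\Omega\to\mathbb{R}$ is a viscosity subsolution of $(*)$ if $\Lambda_1(D^2_{\mathbb{C}}\varphi(z_0))\ge f(z_0)$ whenever $z_0\in\Omega$, $\varphi$ is real-valued and $C^2$ near $z_0$, $\varphi(z_0)=u(z_0)$, and $\varphi\ge u$ near $z_0$. A lower semicontinuous function $v:\Omega\to\mathbb{R}$ is a viscosity supersolution of $(*)$ if $\max\{\Lambda_1(D^2_{\mathbb{C}}\psi(z_0)),0\}\le f(z_0)$ whenever $z_0\in\Omega$, $\psi$ is real-valued and $C^2$ near $z_0$, $\psi(z_0)=v(z_0)$,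 and $\psi\le v$ near $z_0$. Let $u,v:\overline\Omega\to\mathbb{R}$ be such that $u$ is upper semicontinuous on $\overline\Omega$, $v$ is lower semicontinuous on $\overline\Omega$, both are bounded in $\Omega$, $u$ is a viscosity subsolution of $(*)$ and $v$ is a viscosity supersolution of $(*)$. If $u\le v$ on $\partial\Omega$, then $u\le v$ in $\Omega$. -/

import Mathlib

open Topology

/-- `∂g/∂z_j = (∂g/∂x_j - i ∂g/∂y_j) / 2` on `ℂⁿ`, where `z_j = x_j + i y_j`. -/
noncomputable def wirtingerDeriv {n : ℕ} (j : Fin n) (g : EuclideanSpace ℂ (Fin n) → ℂ)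
    (z : EuclideanSpace ℂ (Fin n)) : ℂ :=
  (fderiv ℝ g z (EuclideanSpace.single j 1)
    - Complex.I * fderiv ℝ g z (EuclideanSpace.single j Complex.I)) / 2

/-- `∂g/∂z̄_j = (∂g/∂x_j + i ∂g/∂y_j) / 2` on `ℂⁿ`, where `z_j = x_j + i y_j`. -/
noncomputable def wirtingerDerivBar {n : ℕ} (j : Fin n) (g : EuclideanSpace ℂ (Fin n) → ℂ)
    (z : EuclideanSpace ℂ (Fin n)) : ℂ :=
  (fderiv ℝ g z (EuclideanSpace.single j 1)
    + Complex.I * fderiv ℝ g z (EuclideanSpace.single j Complex.I)) / 2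

/-- The complex Hessian matrix `(∂²φ / ∂z_j ∂z̄_k)_{j,k}` of a real-valued function. -/
noncomputable def complexHessian {n : ℕ} (φ : EuclideanSpace ℂ (Fin n) → ℝ)
    (z : EuclideanSpace ℂ (Fin n)) : Matrix (Fin n) (Fin n) ℂ :=
  Matrix.of fun j k => wirtingerDeriv j (wirtingerDerivBar k fun w => (φ w : ℂ)) z

/-- The smallest eigenvalue `Λ₁(A)` of a Hermitian matrix `A` of positive size, whose set of
eigenvalues is finite, non-empty and real. -/
noncomputable def firstEigenvalue {n : ℕ} (A : Matrix (Fin n) (Fin n) ℂ) : ℝ :=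
  sInf {r : ℝ | Module.End.HasEigenvalue (Matrix.toLin' A) (r : ℂ)}

/-- `φ` is of class `C²` near `z₀` and touches `u` from above at `z₀`. -/
def TouchesFromAbove {n : ℕ} (φ u : EuclideanSpace ℂ (Fin n) → ℝ)
    (z₀ : EuclideanSpace ℂ (Fin n)) : Prop :=
  ContDiffAt ℝ 2 φ z₀ ∧ φ z₀ = u z₀ ∧ ∀ᶠ z in 𝓝 z₀, u z ≤ φ z

/-- `φ` is of class `C²` near `z₀` and touches `u` from below at `z₀`. -/
def TouchesFromBelow {n : ℕ} (φ u : EuclideanSpace ℂ (Fin n) → ℝ)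
    (z₀ : EuclideanSpace ℂ (Fin n)) : Prop :=
  ContDiffAt ℝ 2 φ z₀ ∧ φ z₀ = u z₀ ∧ ∀ᶠ z in 𝓝 z₀, φ z ≤ u z

/-- Real-valued viscosity subsolutions of `Λ₁(D²_ℂ u) = f` in the open set `Ω`; only the values
of `u` and `f` in `Ω` matter. -/
structure IsViscositySubsolution {n : ℕ} (Ω : Set (EuclideanSpace ℂ (Fin n)))
    (f u : EuclideanSpace ℂ (Fin n) → ℝ) : Prop where
  upperSemicontinuousOn : UpperSemicontinuousOn u Ω
  le_firstEigenvalue : ∀ z₀ ∈ Ω, ∀ φ : EuclideanSpace ℂ (Fin n) → ℝ,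
    TouchesFromAbove φ u z₀ → f z₀ ≤ firstEigenvalue (complexHessian φ z₀)

/-- Real-valued viscosity supersolutions of `Λ₁(D²_ℂ v) = f` in the open set `Ω`; only the values
of `v` and `f` in `Ω` matter. -/
structure IsViscositySupersolution {n : ℕ} (Ω : Set (EuclideanSpace ℂ (Fin n)))
    (f v : EuclideanSpace ℂ (Fin n) → ℝ) : Prop where
  lowerSemicontinuousOn : LowerSemicontinuousOn v Ω
  firstEigenvalue_le : ∀ z₀ ∈ Ω, ∀ ψ : EuclideanSpace ℂ (Fin n) → ℝ,
    TouchesFromBelow ψ v z₀ → max (firstEigenvalue (complexHessian ψ z₀)) 0 ≤ f z₀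

/-! The condition `Λ₁ ≥ c` says that the Levi form is at least `c ‖ξ‖²` in every direction, that is,
that `u - c ‖z‖²` is plurisubharmonic. This condition survives averaging, so a viscosity subsolution
with constant right-hand side can be smoothed, and only one nonsmooth function remains to be
compared.

Suppose `u > v` somewhere. For small `a > 0` the function `u - v + a ‖z‖²` attains its maximum over
the closure at some `z₀ ∈ Ω`. Near `z₀`, `f` is almost constant, so `u` satisfies the Levi bound
with `c` slightly below `f z₀`. Subtracting `b ‖z - z₀‖²`, with `0 < b < a`, makes the maximum
strict. After `u` is replaced by a smooth `w`, an interior maximum still exists, and there `w + a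
‖z‖² - b ‖z - z₀‖²`, up to a constant, touches `v` from below with Levi form at least `(c + a - b)
‖ξ‖²`. This exceeds what the supersolution property allows.

The smoothing is `exists_contDiff_approx`. A sup-convolution makes `u` Lipschitz and keeps the
viscosity bound. `HasLeviLowerBoundAt.add_le_circleAverage` turns that bound into a sub-mean value
inequality on complex discs, mollification preserves the inequality, and for `C²` functions it gives
back the Levi bound (`le_leviForm_of_eventually_le_circleAverage`). -/

/-- The sesquilinear form on a complex vector space obtained by complexifying a real bilinear
form. -/
noncomputable def leviSesq {E : Type*} [NormedAddCommGroup E] [NormedSpace ℂ E]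
    (B : E →L[ℝ] E →L[ℝ] ℝ) (x y : E) : ℂ :=
  (((B x y + B (Complex.I • x) (Complex.I • y) : ℝ) : ℂ)
    + ((B x (Complex.I • y) - B (Complex.I • x) y : ℝ) : ℂ) * Complex.I) / 4

/-- The Levi form of `φ` at `z` in the direction `ξ`. -/
noncomputable def leviForm {E : Type*} [NormedAddCommGroup E] [NormedSpace ℂ E]
    (φ : E → ℝ) (z ξ : E) : ℝ :=
  (fderiv ℝ (fderiv ℝ φ) z ξ ξ
    + fderiv ℝ (fderiv ℝ φ) z (Complex.I • ξ) (Complex.I • ξ)) / 4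

/-! ### Sesquilinear algebra of the complexified real Hessian. -/

section Sesquilinear

variable {E : Type*} [NormedAddCommGroup E] [NormedSpace ℂ E] (B : E →L[ℝ] E →L[ℝ] ℝ)

lemma complex_smul_eq_re_add_im (a : ℂ) (x : E) : a • x = a.re • x + a.im • Complex.I • x := by
  conv_lhs => rw [← Complex.re_add_im a, add_smul, mul_smul]
  simp [Complex.coe_smul]

lemma I_smul_I_smul (x : E) : Complex.I • Complex.I • x = -x := by
  rw [smul_smul, Complex.I_mul_I, neg_one_smul]

lemma leviSesq_add_left (x x' y : E) :
    leviSesq B (x + x') y = leviSesq B x y + leviSesq B x' y := by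
  simp only [leviSesq, smul_add, map_add, add_apply]
  push_cast; ring

lemma leviSesq_add_right (x y y' : E) :
    leviSesq B x (y + y') = leviSesq B x y + leviSesq B x y' := by
  simp only [leviSesq, smul_add, map_add]
  push_cast; ring

lemma leviSesq_smul_left (a : ℂ) (x y : E) : leviSesq B (a • x) y = a * leviSesq B x y := by
  have h : Complex.I • a • x = a.re • Complex.I • x - a.im • x := by
    rw [complex_smul_eq_re_add_im a, smul_add, smul_comm _ a.re, smul_comm _ a.im,
      I_smul_I_smul, smul_neg, sub_eq_add_neg]
  rw [leviSesq, h, complex_smul_eq_re_add_im a x]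
  conv_rhs => rw [← Complex.re_add_im a]
  simp only [leviSesq, map_add, map_sub, map_smul, add_apply, sub_apply, smul_apply, smul_eq_mul]
  push_cast
  linear_combination (-(a.im : ℂ) * (B x (Complex.I • y) - B (Complex.I • x) y) / 4)
    * Complex.I_sq

lemma leviSesq_smul_right (a : ℂ) (x y : E) :
    leviSesq B x (a • y) = starRingEnd ℂ a * leviSesq B x y := by
  have h : Complex.I • a • y = a.re • Complex.I • y - a.im • y := by
    rw [complex_smul_eq_re_add_im a, smul_add, smul_comm _ a.re, smul_comm _ a.im,
      I_smul_I_smul, smul_neg, sub_eq_add_neg]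
  rw [leviSesq, h, complex_smul_eq_re_add_im a y]
  conv_rhs => rw [← Complex.re_add_im a]
  simp only [leviSesq, map_add, map_sub, map_smul, smul_eq_mul, map_mul, Complex.conj_I, Complex.conj_ofReal]
  push_cast
  linear_combination ((a.im : ℂ) * (B x (Complex.I • y) - B (Complex.I • x) y) / 4)
    * Complex.I_sq

lemma leviSesq_zero_left (y : E) : leviSesq B 0 y = 0 := by simp [leviSesq]

lemma leviSesq_zero_right (x : E) : leviSesq B x 0 = 0 := by simp [leviSesq]

lemma leviSesq_sum_left {ι : Type*} (s : Finset ι) (x : ι → E) (y : E) :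
    leviSesq B (∑ i ∈ s, x i) y = ∑ i ∈ s, leviSesq B (x i) y := by
  classical
  induction s using Finset.induction_on with
  | empty => simp [leviSesq_zero_left]
  | insert i s hi ih => rw [Finset.sum_insert hi, Finset.sum_insert hi, leviSesq_add_left, ih]

lemma leviSesq_sum_right {ι : Type*} (s : Finset ι) (x : E) (y : ι → E) :
    leviSesq B x (∑ i ∈ s, y i) = ∑ i ∈ s, leviSesq B x (y i) := by
  classical
  induction s using Finset.induction_on with
  | empty => simp [leviSesq_zero_right]
  | insert i s hi ih => rw [Finset.sum_insert hi, Finset.sum_insert hi, leviSesq_add_right, ih]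

lemma leviSesq_self (hB : ∀ x y, B x y = B y x) (x : E) :
    leviSesq B x x = ((B x x + B (Complex.I • x) (Complex.I • x)) / 4 : ℝ) := by
  rw [leviSesq, hB x (Complex.I • x)]
  push_cast; ring

lemma conj_leviSesq (hB : ∀ x y, B x y = B y x) (x y : E) :
    starRingEnd ℂ (leviSesq B x y) = leviSesq B y x := by
  simp only [leviSesq, map_div₀, map_add, map_mul, Complex.conj_ofReal, Complex.conj_I,
    hB y x, hB y (Complex.I • x), hB (Complex.I • y) x, hB (Complex.I • y) (Complex.I • x)]
  push_cast
  rw [show starRingEnd ℂ 4 = 4 from Complex.conj_ofNat 4]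
  ring

end Sesquilinear

/-! ### The complex Hessian in terms of the Levi form. -/

section ComplexHessian

variable {n : ℕ} {φ : EuclideanSpace ℂ (Fin n) → ℝ} {z : EuclideanSpace ℂ (Fin n)}

lemma ContDiffAt.eventually_differentiableAt_two {E : Type*} [NormedAddCommGroup E]
    [NormedSpace ℝ E] {φ : E → ℝ} {z : E} (h : ContDiffAt ℝ 2 φ z) :
    ∀ᶠ w in 𝓝 z, DifferentiableAt ℝ φ w := by
  filter_upwards [h.eventually (by simp)] with w hw
  exact hw.differentiableAt (by simp)

lemma ContDiffAt.differentiableAt_fderiv_two {E : Type*} [NormedAddCommGroup E]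
    [NormedSpace ℝ E] {φ : E → ℝ} {z : E} (h : ContDiffAt ℝ 2 φ z) :
    DifferentiableAt ℝ (fderiv ℝ φ) z :=
  (h.fderiv_right (m := 1) (by norm_num)).differentiableAt (by simp)

lemma ContDiffAt.fderiv_fderiv_symm {E : Type*} [NormedAddCommGroup E]
    [NormedSpace ℝ E] {φ : E → ℝ} {z : E} (h : ContDiffAt ℝ 2 φ z) (x y : E) :
    fderiv ℝ (fderiv ℝ φ) z x y = fderiv ℝ (fderiv ℝ φ) z y x :=
  h.isSymmSndFDerivAt (by simp) x y

lemma complexHessian_apply (h : ContDiffAt ℝ 2 φ z) (j k : Fin n) :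
    complexHessian φ z j k = leviSesq (fderiv ℝ (fderiv ℝ φ) z)
      (EuclideanSpace.single j 1) (EuclideanSpace.single k 1) := by
  have hI : ∀ i : Fin n, (EuclideanSpace.single i Complex.I : EuclideanSpace ℂ (Fin n))
      = Complex.I • EuclideanSpace.single i 1 := by
    intro i; ext l; simp
  have h1 : wirtingerDerivBar k (fun w => (φ w : ℂ)) =ᶠ[𝓝 z] fun w =>
      ((fderiv ℝ φ w (EuclideanSpace.single k 1) : ℂ)
        + Complex.I * (fderiv ℝ φ w (EuclideanSpace.single k Complex.I) : ℂ)) / 2 := by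
    filter_upwards [h.eventually_differentiableAt_two] with w hw
    have : fderiv ℝ (fun w => (φ w : ℂ)) w = Complex.ofRealCLM.comp (fderiv ℝ φ w) :=
      (Complex.ofRealCLM.hasFDerivAt.comp w hw.hasFDerivAt).fderiv
    simp [wirtingerDerivBar, this]
  have hd : ∀ y, HasFDerivAt (fun w => (fderiv ℝ φ w y : ℂ))
      (Complex.ofRealCLM.comp ((fderiv ℝ (fderiv ℝ φ) z).flip y)) z := by
    intro y
    have := h.differentiableAt_fderiv_two.hasFDerivAt.clm_apply (hasFDerivAt_const y z)
    refine Complex.ofRealCLM.hasFDerivAt.comp z (this.congr_fderiv ?_)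
    ext x; simp
  have h2 := (((hd (EuclideanSpace.single k 1)).add
    ((hd (EuclideanSpace.single k Complex.I)).const_mul Complex.I)).mul_const (2⁻¹ : ℂ)).fderiv
  have h3 : fderiv ℝ (wirtingerDerivBar k (fun w => (φ w : ℂ))) z = _ :=
    (h1.fderiv_eq).trans ((by simp only [div_eq_mul_inv]; rfl : _ = _).trans h2)
  rw [complexHessian, Matrix.of_apply, wirtingerDeriv, h3]
  simp only [hI, leviSesq]
  simp
  linear_combination (-((fderiv ℝ (fderiv ℝ φ) z (Complex.I • EuclideanSpace.single j 1)
    (Complex.I • EuclideanSpace.single k 1) : ℝ) : ℂ) / 4) * Complex.I_sq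

lemma complexHessian_isHermitian (h : ContDiffAt ℝ 2 φ z) : (complexHessian φ z).IsHermitian := by
  ext j k
  rw [Matrix.conjTranspose_apply, complexHessian_apply h, complexHessian_apply h]
  exact conj_leviSesq _ h.fderiv_fderiv_symm _ _

/-- The second index of the Hessian carries the conjugate derivative, so the conjugated vector
stands on the right, opposite to the usual `star x ⬝ᵥ A.mulVec x`. -/
lemma dotProduct_complexHessian_mulVec (h : ContDiffAt ℝ 2 φ z) (ξ : EuclideanSpace ℂ (Fin n)) :
    ξ.ofLp ⬝ᵥ (complexHessian φ z).mulVec (star ξ.ofLp) = (leviForm φ z ξ : ℝ) := by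
  have hξ : ξ = ∑ i, ξ i • EuclideanSpace.single i (1 : ℂ) := by
    ext l; simp [Pi.single_apply]
  have key := leviSesq_self _ h.fderiv_fderiv_symm ξ
  rw [leviForm, ← key]
  conv_rhs => rw [hξ]
  rw [leviSesq_sum_left]
  simp only [dotProduct, Matrix.mulVec, complexHessian_apply h, leviSesq_sum_right,
    leviSesq_smul_left, leviSesq_smul_right, Finset.mul_sum]
  refine Finset.sum_congr rfl fun i _ => Finset.sum_congr rfl fun k _ => ?_
  simp only [Pi.star_apply, RCLike.star_def]
  ring

end ComplexHessian

/-! ### Variational description of the smallest eigenvalue. -/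

section FirstEigenvalue

variable {n : ℕ} {A : Matrix (Fin n) (Fin n) ℂ}

lemma eigenvalue_set_eq_range (hA : A.IsHermitian) :
    {r : ℝ | Module.End.HasEigenvalue (Matrix.toLin' A) (r : ℂ)} = Set.range hA.eigenvalues := by
  rw [← hA.spectrum_real_eq_range_eigenvalues]
  ext r
  rw [Set.mem_ofPred_eq, Module.End.hasEigenvalue_iff_mem_spectrum, Matrix.spectrum_toLin',
    ← spectrum.algebraMap_mem_iff ℂ]
  rfl

/-- Positive size matters: the infimum of the empty set has the default value 0. -/
lemma le_firstEigenvalue_iff_eigenvalues (hn : 1 ≤ n) (hA : A.IsHermitian) (c : ℝ) :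
    c ≤ firstEigenvalue A ↔ ∀ i, c ≤ hA.eigenvalues i := by
  have : Nonempty (Fin n) := ⟨⟨0, hn⟩⟩
  rw [firstEigenvalue, eigenvalue_set_eq_range hA,
    le_csInf_iff (Set.finite_range _).bddBelow (Set.range_nonempty _), Set.forall_mem_range]

open scoped ComplexOrder in
lemma le_firstEigenvalue_iff (hn : 1 ≤ n) (hA : A.IsHermitian) (c : ℝ) :
    c ≤ firstEigenvalue A ↔
      ∀ x : Fin n → ℂ, c * ‖WithLp.toLp 2 x‖ ^ 2 ≤ (star x ⬝ᵥ A.mulVec x).re := by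
  have hnorm : ∀ x : Fin n → ℂ, star x ⬝ᵥ x = ((‖WithLp.toLp 2 x‖ ^ 2 : ℝ) : ℂ) := by
    intro x
    rw [EuclideanSpace.norm_sq_eq, dotProduct]
    push_cast
    refine Finset.sum_congr rfl fun i _ => ?_
    rw [Pi.star_apply, RCLike.star_def, Complex.conj_mul']
  rw [le_firstEigenvalue_iff_eigenvalues hn hA]
  constructor
  · intro h x
    -- The eigenvalues of `A - c` are those of `A` shifted by `-c`, so the bound says that `A - c`
    -- is positive semidefinite.
    have hAc : (A - (c : ℂ) • (1 : Matrix (Fin n) (Fin n) ℂ)).IsHermitian := by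
      refine hA.sub ?_
      ext i j
      by_cases hij : i = j <;> simp [hij, eq_comm]
    have hpsd : (A - (c : ℂ) • (1 : Matrix (Fin n) (Fin n) ℂ)).PosSemidef := by
      rw [hAc.posSemidef_iff_eigenvalues_nonneg]
      intro i
      have h1 : (hAc.eigenvalues i + c) ∈ Set.range hA.eigenvalues := by
        have h2 : hAc.eigenvalues i ∈
          {r : ℝ | Module.End.HasEigenvalue
            (Matrix.toLin' (A - (c : ℂ) • (1 : Matrix (Fin n) (Fin n) ℂ))) (r : ℂ)} := by
          rw [eigenvalue_set_eq_range hAc]; exact ⟨i, rfl⟩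
        rw [← eigenvalue_set_eq_range hA]
        obtain ⟨v, hv⟩ := h2.exists_hasEigenvector
        refine Module.End.hasEigenvalue_of_hasEigenvector (x := v)
          (Module.End.hasEigenvector_iff.2 ⟨Module.End.mem_eigenspace_iff.2 ?_, hv.2⟩)
        have := hv.apply_eq_smul
        simp only [Matrix.toLin'_apply, Matrix.sub_mulVec, Matrix.smul_mulVec,
          Matrix.one_mulVec] at this ⊢
        push_cast
        rw [add_smul, ← this]; abel
      obtain ⟨k, hk⟩ := h1
      have := h k
      rw [hk] at this
      simpa using this
    have := hpsd.re_dotProduct_nonneg x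
    rw [Matrix.sub_mulVec, dotProduct_sub, Matrix.smul_mulVec, Matrix.one_mulVec,
      dotProduct_smul, hnorm, smul_eq_mul, ← Complex.ofReal_mul, RCLike.re_eq_complex_re,
      Complex.sub_re, Complex.ofReal_re] at this
    linarith
  · intro h i
    have h2 : hA.eigenvalues i ∈
        {r : ℝ | Module.End.HasEigenvalue (Matrix.toLin' A) (r : ℂ)} := by
      rw [eigenvalue_set_eq_range hA]; exact ⟨i, rfl⟩
    obtain ⟨v, hv⟩ := h2.exists_hasEigenvector
    have h3 := h v
    have := hv.apply_eq_smul
    rw [Matrix.toLin'_apply] at this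
    rw [this, dotProduct_smul, hnorm, smul_eq_mul, ← Complex.ofReal_mul, Complex.ofReal_re] at h3
    have hv0 : (WithLp.toLp 2 v : EuclideanSpace ℂ (Fin n)) ≠ 0 := by
      simpa using hv.2
    exact le_of_mul_le_mul_right h3 (by positivity)

/-- The smallest eigenvalue of the complex Hessian is the best lower bound of the Levi form. -/
lemma le_firstEigenvalue_complexHessian_iff (hn : 1 ≤ n) {φ : EuclideanSpace ℂ (Fin n) → ℝ}
    {z : EuclideanSpace ℂ (Fin n)} (h : ContDiffAt ℝ 2 φ z) (c : ℝ) :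
    c ≤ firstEigenvalue (complexHessian φ z) ↔ ∀ ξ, c * ‖ξ‖ ^ 2 ≤ leviForm φ z ξ := by
  have hs : ∀ x : Fin n → ℂ, ‖WithLp.toLp 2 (star x)‖ = ‖WithLp.toLp 2 x‖ := by
    intro x
    simp [EuclideanSpace.norm_eq]
  rw [le_firstEigenvalue_iff hn (complexHessian_isHermitian h)]
  constructor
  · intro H ξ
    have := H (star ξ.ofLp)
    rwa [star_star, dotProduct_complexHessian_mulVec h, Complex.ofReal_re, hs] at this
  · intro H x
    have := H (WithLp.toLp 2 (star x))
    rw [hs, ← Complex.ofReal_re (leviForm _ _ _), ← dotProduct_complexHessian_mulVec h] at this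
    simpa using this

end FirstEigenvalue

/-! ### Second-order Taylor expansion. -/

section Taylor

variable {E : Type*} [NormedAddCommGroup E] [NormedSpace ℝ E]

lemma ContDiffAt.eventually_abs_taylor_two_le {φ : E → ℝ} {z : E} (h : ContDiffAt ℝ 2 φ z)
    {ε : ℝ} (hε : 0 < ε) :
    ∀ᶠ v in 𝓝 (0 : E), |φ (z + v) - (φ z + fderiv ℝ φ z v
      + fderiv ℝ (fderiv ℝ φ) z v v / 2)| ≤ ε * ‖v‖ ^ 2 := by
  set B := fderiv ℝ (fderiv ℝ φ) z with hB
  have hadd : Filter.Tendsto (fun v : E => z + v) (𝓝 0) (𝓝 z) := by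
    simpa using (continuous_const_add z).tendsto (0 : E)
  have h1 := hadd.eventually h.eventually_differentiableAt_two
  have h2 := (hasFDerivAt_iff_isLittleO_nhds_zero.1 h.differentiableAt_fderiv_two.hasFDerivAt).def hε
  obtain ⟨δ, hδ, H⟩ := Metric.eventually_nhds_iff_ball.1 (h1.and h2)
  filter_upwards [Metric.ball_mem_nhds (0 : E) hδ] with v hv
  -- The derivative of the remainder is the first-order error of `fderiv ℝ φ`, at most `ε ‖x‖`; the
  -- mean value inequality on the ball of radius `‖v‖` supplies the second factor `‖v‖`.
  set R : E → ℝ := fun v => φ (z + v) - (φ z + fderiv ℝ φ z v + B v v / 2) with hR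
  have hsub : Metric.closedBall (0 : E) ‖v‖ ⊆ Metric.ball 0 δ :=
    Metric.closedBall_subset_ball (by simpa using hv)
  have hderiv : ∀ x ∈ Metric.closedBall (0 : E) ‖v‖,
      HasFDerivWithinAt R (fderiv ℝ φ (z + x) - fderiv ℝ φ z - B x)
        (Metric.closedBall (0 : E) ‖v‖) x := by
    intro x hx
    have hd := (H x (hsub hx)).1
    have a1 : HasFDerivAt (fun v : E => φ (z + v)) (fderiv ℝ φ (z + x)) x := by
      exact (hd.hasFDerivAt.comp x ((hasFDerivAt_id x).const_add z)).congr_fderiv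
        (ContinuousLinearMap.comp_id _)
    have a2 : HasFDerivAt (fun v : E => B v v / 2) (B x) x := by
      have := (B.hasFDerivAt.clm_apply (hasFDerivAt_id x)).mul_const (2⁻¹ : ℝ)
      refine this.congr_fderiv ?_
      ext y
      have hs : B y x = B x y := h.fderiv_fderiv_symm y x
      simp [hs]
      ring
    have := a1.sub (((fderiv ℝ φ z).hasFDerivAt.const_add (φ z)).add a2)
    refine (this.congr_fderiv ?_).hasFDerivWithinAt
    abel
  have hbound : ∀ x ∈ Metric.closedBall (0 : E) ‖v‖,
      ‖fderiv ℝ φ (z + x) - fderiv ℝ φ z - B x‖ ≤ ε * ‖v‖ := by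
    intro x hx
    refine ((H x (hsub hx)).2).trans ?_
    have : ‖x‖ ≤ ‖v‖ := by simpa using hx
    gcongr
  have := (convex_closedBall (0 : E) ‖v‖).norm_image_sub_le_of_norm_hasFDerivWithin_le
    hderiv hbound (x := 0) (y := v) (by simp) (by simp)
  have hR0 : R 0 = 0 := by simp [hR]
  rw [hR0, sub_zero, sub_zero, Real.norm_eq_abs] at this
  calc _ ≤ ε * ‖v‖ * ‖v‖ := this
    _ = _ := by ring

end Taylor

/-! ### Levi form and circle averages. -/

section CircleAverage

open Real

lemma Continuous.circleIntegrable_real {F : ℂ → ℝ} (hF : Continuous F) (c : ℂ) (r : ℝ) :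
    CircleIntegrable F c r := hF.continuousOn.circleIntegrable'

lemma circleAverage_re_add_normSq {P : ℂ → ℂ} (hP : Differentiable ℂ P) (κ r : ℝ) :
    circleAverage (fun s => (P s).re + κ * ‖s‖ ^ 2) 0 r = (P 0).re + κ * r ^ 2 := by
  have h1 : circleAverage (fun s => (P s).re) 0 r = (P 0).re := by
    have := Complex.reCLM.circleAverage_comp_comm (f := P) (c := 0) (R := r)
      hP.continuous.continuousOn.circleIntegrable'
    rw [hP.diffContOnCl.circleAverage] at this
    exact this
  have h2 : circleAverage (fun s : ℂ => κ * ‖s‖ ^ 2) 0 r = κ * r ^ 2 :=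
    circleAverage_const_on_circle fun s hs => by
      rw [mem_sphere_zero_iff_norm] at hs
      rw [hs, sq_abs]
  rw [circleAverage_fun_add (f₁ := fun s => (P s).re) (Continuous.circleIntegrable_real
    (Complex.continuous_re.comp hP.continuous) 0 r)
    (Continuous.circleIntegrable_real (by fun_prop) 0 r), h1, h2]

variable {E : Type*} [NormedAddCommGroup E] [NormedSpace ℂ E]

/-- On a complex line a real quadratic polynomial splits into a harmonic part, the real part of a
holomorphic quadratic, and a multiple of `‖s‖²`, which is the Levi form. Circle averages see only
the value at the center and the latter. -/
lemma exists_taylor_eq_re_add_leviForm {φ : E → ℝ} {z : E} (h : ContDiffAt ℝ 2 φ z) (ξ : E) :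
    ∃ P : ℂ → ℂ, Differentiable ℂ P ∧ (P 0).re = φ z ∧ ∀ s : ℂ,
      φ z + fderiv ℝ φ z (s • ξ) + fderiv ℝ (fderiv ℝ φ) z (s • ξ) (s • ξ) / 2
        = (P s).re + leviForm φ z ξ * ‖s‖ ^ 2 := by
  set D := fderiv ℝ φ z
  set B := fderiv ℝ (fderiv ℝ φ) z
  have hB : B (Complex.I • ξ) ξ = B ξ (Complex.I • ξ) := h.fderiv_fderiv_symm _ _
  refine ⟨fun s => φ z + (D ξ - Complex.I * D (Complex.I • ξ)) * s
    + (((B ξ ξ - B (Complex.I • ξ) (Complex.I • ξ)) / 4 : ℝ)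
      - Complex.I * ((B ξ (Complex.I • ξ) / 2 : ℝ))) * s ^ 2, by fun_prop, by simp, fun s => ?_⟩
  rw [leviForm, complex_smul_eq_re_add_im s ξ, ← Complex.normSq_eq_norm_sq, Complex.normSq_apply]
  simp only [map_add, map_smul, add_apply, smul_apply, smul_eq_mul, hB, Complex.add_re,
    Complex.sub_re, Complex.mul_re, Complex.ofReal_re, Complex.ofReal_im, Complex.I_re,
    Complex.I_im, Complex.sub_im, Complex.mul_im, pow_two]
  ring

/-- Circle averages of a `C²` function over small circles in a complex line are controlled by its
Levi form. -/
lemma eventually_abs_circleAverage_sub_le {φ : E → ℝ} {z : E} (h : ContDiffAt ℝ 2 φ z) (ξ : E)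
    {ε : ℝ} (hε : 0 < ε) :
    ∀ᶠ r in 𝓝[>] (0 : ℝ), |circleAverage (fun s => φ (z + s • ξ)) 0 r
      - (φ z + leviForm φ z ξ * r ^ 2)| ≤ ε * r ^ 2 := by
  obtain ⟨P, hP, hP0, hPs⟩ := exists_taylor_eq_re_add_leviForm h ξ
  have hε' : 0 < ε / (‖ξ‖ ^ 2 + 1) := by positivity
  have htend : Filter.Tendsto (fun s : ℂ => s • ξ) (𝓝 0) (𝓝 0) := by
    have : Continuous fun s : ℂ => s • ξ := by fun_prop
    simpa using this.tendsto 0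
  have htend' : Filter.Tendsto (fun s : ℂ => z + s • ξ) (𝓝 0) (𝓝 z) := by
    simpa using htend.const_add z
  have h1 := htend.eventually (h.eventually_abs_taylor_two_le hε')
  have h2 := htend'.eventually h.eventually_differentiableAt_two
  obtain ⟨δ, hδ, H⟩ := Metric.eventually_nhds_iff_ball.1 (h1.and h2)
  filter_upwards [Ioo_mem_nhdsGT hδ] with r hr
  have hr0 : |r| = r := abs_of_pos hr.1
  have hmem : ∀ s ∈ Metric.sphere (0 : ℂ) |r|, s ∈ Metric.ball (0 : ℂ) δ := by
    intro s hs
    rw [hr0, mem_sphere_zero_iff_norm] at hs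
    rw [mem_ball_zero_iff, hs]; exact hr.2
  have hint : CircleIntegrable (fun s => φ (z + s • ξ)) 0 r := by
    refine ContinuousOn.circleIntegrable' fun s hs => ContinuousAt.continuousWithinAt ?_
    have hd := (H s (hmem s hs)).2.continuousAt
    exact ContinuousAt.comp (f := fun s : ℂ => z + s • ξ) hd (by fun_prop)
  have hclose : ∀ s ∈ Metric.sphere (0 : ℂ) |r|,
      |φ (z + s • ξ) - ((P s).re + leviForm φ z ξ * ‖s‖ ^ 2)| ≤ ε * ‖s‖ ^ 2 := by
    intro s hs
    have := (H s (hmem s hs)).1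
    rw [hPs] at this
    refine this.trans ?_
    rw [norm_smul, mul_pow, mul_comm (‖s‖ ^ 2), ← mul_assoc]
    gcongr
    rw [div_mul_eq_mul_div, div_le_iff₀ (by positivity)]
    nlinarith
  have hcont : ∀ κ : ℝ, CircleIntegrable (fun s => (P s).re + κ * ‖s‖ ^ 2) 0 r := fun κ =>
    Continuous.circleIntegrable_real
      ((Complex.continuous_re.comp hP.continuous).add (by fun_prop)) 0 r
  have hup := circleAverage_mono hint (hcont (leviForm φ z ξ + ε)) (fun s hs => by
    have := (abs_le.1 (hclose s hs)).2; linarith)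
  have hlow := circleAverage_mono (hcont (leviForm φ z ξ - ε)) hint (fun s hs => by
    have := (abs_le.1 (hclose s hs)).1; linarith)
  rw [circleAverage_re_add_normSq hP, hP0] at hup hlow
  rw [abs_le]
  constructor <;> linarith

lemma le_leviForm_of_eventually_le_circleAverage {φ : E → ℝ} {z : E} (h : ContDiffAt ℝ 2 φ z)
    {ξ : E} {κ : ℝ} (hκ : ∀ᶠ r in 𝓝[>] (0 : ℝ),
      φ z + κ * r ^ 2 ≤ circleAverage (fun s => φ (z + s • ξ)) 0 r) :
    κ ≤ leviForm φ z ξ := by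
  refine le_of_forall_pos_le_add fun ε hε => ?_
  obtain ⟨r, ⟨hr1, hr2⟩, hr0⟩ :=
    ((hκ.and (eventually_abs_circleAverage_sub_le h ξ hε)).and self_mem_nhdsWithin).exists
  have := (abs_le.1 hr2).2
  have hr : 0 < r := hr0
  refine le_of_mul_le_mul_right (a := r ^ 2) ?_ (by positivity)
  linarith

lemma leviForm_eq_of_eq_re_add {φ : E → ℝ} {z : E} (h : ContDiffAt ℝ 2 φ z) {ξ : E} {κ : ℝ}
    {P : ℂ → ℂ} (hP : Differentiable ℂ P) (hφ : ∀ s : ℂ, φ (z + s • ξ) = (P s).re + κ * ‖s‖ ^ 2) :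
    leviForm φ z ξ = κ := by
  have h0 : φ z = (P 0).re := by simpa using hφ 0
  refine le_antisymm (le_of_forall_pos_le_add fun ε hε => ?_)
    (le_leviForm_of_eventually_le_circleAverage h (Filter.Eventually.of_forall fun r => ?_))
  · obtain ⟨r, hr2, hr0⟩ :=
      ((eventually_abs_circleAverage_sub_le h ξ hε).and self_mem_nhdsWithin).exists
    simp only [hφ, circleAverage_re_add_normSq hP, h0] at hr2
    have := (abs_le.1 hr2).1
    have hr : 0 < r := hr0
    refine le_of_mul_le_mul_right (a := r ^ 2) ?_ (by positivity)
    linarith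
  · simp only [hφ, circleAverage_re_add_normSq hP, h0, le_refl]

end CircleAverage

/-! ### Approximation on the circle by real parts of entire functions. -/

section TrigonometricApproximation

open Real

lemma exists_differentiable_re_approx_on_circle {F : ℂ → ℝ} (hF : Continuous F) {η : ℝ}
    (hη : 0 < η) :
    ∃ P : ℂ → ℂ, Differentiable ℂ P ∧ ∀ s ∈ Metric.sphere (0 : ℂ) 1, |(P s).re - F s| < η := by
  have : Fact (0 < (1 : ℝ)) := ⟨one_pos⟩
  let G : C(AddCircle (1 : ℝ), ℂ) :=
    ⟨fun x => (F (AddCircle.toCircle x : ℂ) : ℂ), Complex.continuous_ofReal.comp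
      (hF.comp (continuous_subtype_val.comp AddCircle.continuous_toCircle))⟩
  have hG : G ∈ (Submodule.span ℂ (Set.range <| @fourier (1 : ℝ))).topologicalClosure := by
    rw [span_fourier_closure_eq_top]; trivial
  obtain ⟨p, hp, hpG⟩ := Metric.mem_closure_iff.1 hG η hη
  have key : ∃ Q₁ Q₂ : ℂ → ℂ, Differentiable ℂ Q₁ ∧ Differentiable ℂ Q₂ ∧
      ∀ x, p x = Q₁ (AddCircle.toCircle x : ℂ)
        + starRingEnd ℂ (Q₂ (AddCircle.toCircle x : ℂ)) := by
    -- On the unit circle, nonnegative frequencies are powers of `s` and negative ones are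
    -- conjugates of powers.
    refine Submodule.span_induction (p := fun (p : C(AddCircle (1 : ℝ), ℂ)) _ =>
      ∃ Q₁ Q₂ : ℂ → ℂ, Differentiable ℂ Q₁ ∧ Differentiable ℂ Q₂ ∧
      ∀ x, p x = Q₁ (AddCircle.toCircle x : ℂ)
        + starRingEnd ℂ (Q₂ (AddCircle.toCircle x : ℂ))) ?_ ?_ ?_ ?_ hp
    · rintro _ ⟨k, rfl⟩
      have hnat : ∀ (m : ℕ) (x : AddCircle (1 : ℝ)),
          fourier (m : ℤ) x = (AddCircle.toCircle x : ℂ) ^ m := by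
        intro m x
        rw [fourier_apply, AddCircle.toCircle_zsmul]; simp
      obtain ⟨m, rfl | rfl⟩ := Int.eq_nat_or_neg k
      · exact ⟨fun s => s ^ m, fun _ => 0, by fun_prop, by fun_prop, fun x => by
          rw [hnat]; simp⟩
      · exact ⟨fun _ => 0, fun s => s ^ m, by fun_prop, by fun_prop, fun x => by
          rw [fourier_neg, hnat]; simp⟩
    · exact ⟨fun _ => 0, fun _ => 0, by fun_prop, by fun_prop, fun x => by simp⟩
    · rintro p q _ _ ⟨P₁, P₂, h₁, h₂, h⟩ ⟨Q₁, Q₂, k₁, k₂, k⟩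
      refine ⟨fun s => P₁ s + Q₁ s, fun s => P₂ s + Q₂ s, h₁.add k₁, h₂.add k₂, fun x => ?_⟩
      rw [ContinuousMap.add_apply, h, k, map_add]; ring
    · rintro a p _ ⟨P₁, P₂, h₁, h₂, h⟩
      refine ⟨fun s => a * P₁ s, fun s => starRingEnd ℂ a * P₂ s, h₁.const_mul _, h₂.const_mul _,
        fun x => ?_⟩
      rw [ContinuousMap.smul_apply, h, map_mul, Complex.conj_conj, smul_eq_mul]; ring
  obtain ⟨Q₁, Q₂, h₁, h₂, h⟩ := key
  -- Conjugation does not change real parts, so `Q₂` may replace its conjugate.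
  refine ⟨fun s => Q₁ s + Q₂ s, h₁.add h₂, fun s hs => ?_⟩
  obtain ⟨x, hx⟩ := (AddCircle.homeomorphCircle (one_ne_zero (α := ℝ))).surjective
    ⟨s, by simpa [Submonoid.unitSphere] using hs⟩
  have hxs : (AddCircle.toCircle x : ℂ) = s := by
    rw [← AddCircle.homeomorphCircle_apply (one_ne_zero (α := ℝ)), hx]
  have h1 : ‖G x - p x‖ < η := ((ContinuousMap.dist_apply_le_dist x).trans_lt hpG).trans_eq' (by
    rw [dist_eq_norm])
  have h2 := (Complex.abs_re_le_norm _).trans_lt h1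
  rw [h x, hxs] at h2
  have hGx : G x = (F s : ℂ) := by simp only [G, ContinuousMap.coe_mk, hxs]
  rw [hGx] at h2
  rw [abs_sub_comm]
  simpa using h2

end TrigonometricApproximation

/-! ### From viscosity bounds to the sub-mean value inequality. -/

section SubMeanValue

open Real

variable {n : ℕ}

/-- Every `C²` function touching `g` from above at `x` has Levi form at least `c ‖ξ‖²` there. -/
def HasLeviLowerBoundAt (c : ℝ) (g : EuclideanSpace ℂ (Fin n) → ℝ)
    (x : EuclideanSpace ℂ (Fin n)) : Prop :=
  ∀ φ, TouchesFromAbove φ g x → ∀ ξ, c * ‖ξ‖ ^ 2 ≤ leviForm φ x ξ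

lemma norm_add_sq_eq_re (a s : ℂ) :
    ‖a + s‖ ^ 2 = (((‖a‖ ^ 2 : ℝ) : ℂ) + 2 * starRingEnd ℂ a * s).re + ‖s‖ ^ 2 := by
  rw [← Complex.normSq_eq_norm_sq, ← Complex.normSq_eq_norm_sq, ← Complex.normSq_eq_norm_sq]
  simp [Complex.normSq_apply]
  ring

/-- Viscosity subsolutions satisfy the sub-mean value inequality on complex discs. -/
theorem HasLeviLowerBoundAt.add_le_circleAverage {g : EuclideanSpace ℂ (Fin n) → ℝ}
    {L : NNReal} (hg : LipschitzWith L g) {c R : ℝ} {z₀ ξ : EuclideanSpace ℂ (Fin n)}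
    (hsub : ∀ x ∈ Metric.ball z₀ R, HasLeviLowerBoundAt c g x) (hξR : ‖ξ‖ < R) :
    g z₀ + c * ‖ξ‖ ^ 2 ≤ circleAverage (fun s => g (z₀ + s • ξ)) 0 1 := by
  rcases eq_or_ne ξ 0 with rfl | hξ
  · simp [circleAverage_const]
  by_contra! hlt
  set A := circleAverage (fun s => g (z₀ + s • ξ)) 0 1 with hA
  set κ := c * ‖ξ‖ ^ 2 with hκ
  have hξ0 : 0 < ‖ξ‖ := norm_pos_iff.2 hξ
  obtain ⟨η, hη, hηA⟩ : ∃ η > 0, A + 5 * η < g z₀ + κ :=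
    ⟨(g z₀ + κ - A) / 6, by linarith, by linarith⟩
  have hgc : Continuous fun s : ℂ => g (z₀ + s • ξ) := hg.continuous.comp (by fun_prop)
  -- If the inequality fails, `Re P` nearly solves the Dirichlet problem on the disc with boundary
  -- data `g`. A multiple of `‖s‖²` with coefficient `κ - η` is added to it, and the result becomes
  -- a test function whose Levi form along `ξ` is too small.
  obtain ⟨P, hP, hPg⟩ := exists_differentiable_re_approx_on_circle hgc hη
  have hP0 : (P 0).re ≤ A + η := by
    have h1 := circleAverage_re_add_normSq hP (-η) 1
    have h2 := circleAverage_mono (c := 0) (R := 1)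
      (f₁ := fun s => (P s).re + (-η) * ‖s‖ ^ 2) (f₂ := fun s => g (z₀ + s • ξ))
      (Continuous.circleIntegrable_real
        ((Complex.continuous_re.comp hP.continuous).add (by fun_prop)) 0 1)
      (Continuous.circleIntegrable_real hgc 0 1) (fun s hs => by
        rw [abs_one] at hs
        have := (abs_lt.1 (hPg s hs)).2
        rw [mem_sphere_zero_iff_norm] at hs
        rw [hs]; linarith)
    rw [h1] at h2
    linarith
  -- `ℓ` is the coordinate along `ξ` with `ℓ ξ = 1`, and `π'` projects onto the complement; `D` is a
  -- thin tube around the disc.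
  let ℓ : EuclideanSpace ℂ (Fin n) →L[ℂ] ℂ := ((‖ξ‖ ^ 2 : ℝ) : ℂ)⁻¹ • innerSL ℂ ξ
  have hℓ : ℓ ξ = 1 := by
    have : ((‖ξ‖ : ℝ) : ℂ) ≠ 0 := by exact_mod_cast hξ0.ne'
    simp [ℓ, inner_self_eq_norm_sq_to_K, this]
  let π' : EuclideanSpace ℂ (Fin n) →L[ℂ] EuclideanSpace ℂ (Fin n) :=
    ContinuousLinearMap.id ℂ _ - ℓ.smulRight ξ
  have hπ : ∀ w, π' w = w - ℓ w • ξ := fun w => by simp [π']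
  obtain ⟨τ, hτ, hτL, hτR⟩ : ∃ τ > 0, L * τ ≤ η ∧ ‖ξ‖ + τ < R := by
    refine ⟨min (η / (L + 1)) ((R - ‖ξ‖) / 2), lt_min (by positivity) (by linarith), ?_, ?_⟩
    · calc (L : ℝ) * min (η / (L + 1)) ((R - ‖ξ‖) / 2) ≤ (L + 1) * (η / (L + 1)) := by
            gcongr
            · linarith
            · exact min_le_left _ _
        _ = η := by field_simp
    · have := min_le_right (η / (L + 1)) ((R - ‖ξ‖) / 2)
      linarith
  let D : Set (EuclideanSpace ℂ (Fin n)) := {w | ‖ℓ w‖ ≤ 1 ∧ ‖π' w‖ ≤ τ}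
  have hDnorm : ∀ w ∈ D, ‖w‖ ≤ ‖ξ‖ + τ := by
    intro w hw
    have h1 : w = ℓ w • ξ + π' w := by rw [hπ]; abel
    calc ‖w‖ = ‖ℓ w • ξ + π' w‖ := by rw [← h1]
      _ ≤ ‖ℓ w‖ * ‖ξ‖ + ‖π' w‖ := (norm_add_le _ _).trans (by rw [norm_smul])
      _ ≤ 1 * ‖ξ‖ + τ := by gcongr; exacts [hw.1, hw.2]
      _ = _ := by ring
  have hDc : IsCompact D := by
    refine Metric.isCompact_of_isClosed_isBounded ?_ ?_
    · exact (isClosed_le ℓ.continuous.norm continuous_const).inter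
        (isClosed_le π'.continuous.norm continuous_const)
    · exact (Metric.isBounded_closedBall (x := 0) (r := ‖ξ‖ + τ)).subset
        fun w hw => by simpa using hDnorm w hw
  have hD0 : (0 : EuclideanSpace ℂ (Fin n)) ∈ D := by simp [D, hτ.le]
  -- Negative at the center, by the choice of `η`; positive where `‖ℓ w‖ = 1`, since the
  -- approximation error and the Lipschitz error `L * τ` are each at most `η`.
  let b : EuclideanSpace ℂ (Fin n) → ℝ := fun w =>
    (P (ℓ w)).re + 2 * η + (κ - η) * (‖ℓ w‖ ^ 2 - 1) - g (z₀ + w)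
  have hPc := hP.continuous
  have hgc' := hg.continuous
  have hb : Continuous b := by fun_prop
  obtain ⟨w₀, -, hw₀⟩ := hDc.exists_isMinOn ⟨0, hD0⟩ hb.continuousOn
  -- Large enough to make `Ψ` positive where `‖π' w‖ = τ`, so that its negative minimum lies inside
  -- the tube.
  set K := (|b w₀| + 1) / τ ^ 2 with hK
  have hK0 : 0 < K := by positivity
  let Ψ : EuclideanSpace ℂ (Fin n) → ℝ := fun w => b w + K * ‖π' w‖ ^ 2
  have hΨ : Continuous Ψ := by fun_prop
  obtain ⟨w₁, hw₁D, hw₁⟩ := hDc.exists_isMinOn ⟨0, hD0⟩ hΨ.continuousOn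
  have hΨ0 : Ψ w₁ < 0 := by
    refine lt_of_le_of_lt (hw₁ hD0) ?_
    simp only [Ψ, b, map_zero, norm_zero, add_zero]
    nlinarith
  have hw₁ℓ : ‖ℓ w₁‖ < 1 := by
    refine lt_of_le_of_ne hw₁D.1 fun heq => ?_
    have h1 := (abs_lt.1 (hPg (ℓ w₁) (by simpa using heq))).1
    have h2 : g (z₀ + w₁) - g (z₀ + ℓ w₁ • ξ) ≤ L * τ := by
      refine (le_abs_self _).trans ((hg.dist_le_mul _ _).trans ?_)
      rw [dist_add_left, dist_eq_norm, ← hπ]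
      gcongr
      exact hw₁D.2
    have h3 : 0 < b w₁ := by
      simp only [b, heq]
      linarith
    have h4 : 0 ≤ K * ‖π' w₁‖ ^ 2 := by positivity
    simp only [Ψ] at hΨ0
    linarith
  have hw₁π : ‖π' w₁‖ < τ := by
    refine lt_of_le_of_ne hw₁D.2 fun heq => ?_
    have h1 : b w₀ ≤ b w₁ := hw₀ hw₁D
    have h2 : K * τ ^ 2 = |b w₀| + 1 := by rw [hK]; field_simp
    have h3 := neg_abs_le (b w₀)
    simp only [Ψ, heq] at hΨ0
    linarith
  have hx₁ : z₀ + w₁ ∈ Metric.ball z₀ R := by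
    rw [mem_ball_iff_norm, add_sub_cancel_left]
    exact (hDnorm w₁ hw₁D).trans_lt hτR
  let φ : EuclideanSpace ℂ (Fin n) → ℝ := fun x =>
    (P (ℓ (x - z₀))).re + 2 * η + (κ - η) * (‖ℓ (x - z₀)‖ ^ 2 - 1)
      + K * ‖π' (x - z₀)‖ ^ 2 - Ψ w₁
  have hφ : ContDiff ℝ 2 φ := by
    have hsubc : ContDiff ℝ 2 fun x : EuclideanSpace ℂ (Fin n) => x - z₀ := by fun_prop
    have hℓc : ContDiff ℝ 2 fun x => ℓ (x - z₀) := (ℓ.restrictScalars ℝ).contDiff.comp hsubc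
    have hπc : ContDiff ℝ 2 fun x => π' (x - z₀) := (π'.restrictScalars ℝ).contDiff.comp hsubc
    have hP' : ContDiff ℝ 2 P := (hP.contDiff (n := 2)).restrict_scalars ℝ
    have h1 : ContDiff ℝ 2 fun x => (P (ℓ (x - z₀))).re :=
      Complex.reCLM.contDiff.comp (hP'.comp hℓc)
    have h2 : ContDiff ℝ 2 fun x => ‖ℓ (x - z₀)‖ ^ 2 := hℓc.norm_sq ℂ
    have h3 : ContDiff ℝ 2 fun x => ‖π' (x - z₀)‖ ^ 2 := hπc.norm_sq ℂ
    exact (((h1.add contDiff_const).add (contDiff_const.mul (h2.sub contDiff_const))).add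
      (contDiff_const.mul h3)).sub contDiff_const
  have hφg : ∀ x, φ x = g x + (Ψ (x - z₀) - Ψ w₁) := by
    intro x
    simp only [φ, Ψ, b, add_sub_cancel]
    ring
  have htouch : TouchesFromAbove φ g (z₀ + w₁) := by
    refine ⟨hφ.contDiffAt, by simp [hφg], ?_⟩
    have hnear : ∀ᶠ x in 𝓝 (z₀ + w₁), ‖ℓ (x - z₀)‖ < 1 ∧ ‖π' (x - z₀)‖ < τ := by
      refine Filter.Eventually.and ?_ ?_
      · refine ContinuousAt.eventually_lt (by fun_prop) continuousAt_const ?_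
        simpa using hw₁ℓ
      · refine ContinuousAt.eventually_lt (by fun_prop) continuousAt_const ?_
        simpa using hw₁π
    filter_upwards [hnear] with x hx
    have : Ψ w₁ ≤ Ψ (x - z₀) := hw₁ (show x - z₀ ∈ D from ⟨hx.1.le, hx.2.le⟩)
    rw [hφg]; linarith
  have hlow := hsub _ hx₁ φ htouch ξ
  -- Moving along `ξ` leaves `π'` unchanged, so the penalty `K * ‖π'‖²` contributes nothing in this
  -- direction.
  have hup : leviForm φ (z₀ + w₁) ξ ≤ κ - η := by
    let C : ℝ := 2 * η - (κ - η) + K * ‖π' w₁‖ ^ 2 - Ψ w₁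
    refine (leviForm_eq_of_eq_re_add hφ.contDiffAt (P := fun s => P (ℓ w₁ + s)
      + ((κ - η : ℝ) : ℂ) * (((‖ℓ w₁‖ ^ 2 : ℝ) : ℂ) + 2 * starRingEnd ℂ (ℓ w₁) * s) + (C : ℂ))
      ?_ fun s => ?_).le
    · exact ((hP.comp (differentiable_id.const_add _)).add (by fun_prop)).add_const _
    · have h1 : z₀ + w₁ + s • ξ - z₀ = w₁ + s • ξ := by abel
      have h2 : ℓ (w₁ + s • ξ) = ℓ w₁ + s := by simp [hℓ]
      have h3 : π' (w₁ + s • ξ) = π' w₁ := by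
        rw [hπ, hπ, h2, add_smul]; abel
      simp only [φ, h1, h2, h3, norm_add_sq_eq_re, Complex.add_re, Complex.re_ofReal_mul,
        Complex.ofReal_re, C]
      ring
  linarith

end SubMeanValue

/-! ### Sup-convolution and translation of test functions. -/

section SupConvolution

variable {n : ℕ}

/-- The penalty is a cone rather than a paraboloid: a supremum of `k`-Lipschitz functions is
globally `k`-Lipschitz, and compactness makes it attained. -/
lemma exists_supConvolution {E : Type*} [PseudoMetricSpace E] {u : E → ℝ} {K : Set E}
    (hK : IsCompact K) (hne : K.Nonempty) (hu : UpperSemicontinuousOn u K) (k : NNReal) :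
    ∃ g : E → ℝ, LipschitzWith k g ∧ (∀ x, ∃ y ∈ K, g x = u y - k * dist x y) ∧
      ∀ x, ∀ y ∈ K, u y - k * dist x y ≤ g x := by
  have hmax : ∀ x, ∃ y ∈ K, IsMaxOn (fun y => u y + (-(k * dist x y))) K y := fun x =>
    UpperSemicontinuousOn.exists_isMaxOn hne hK
      (hu.add (ContinuousOn.upperSemicontinuousOn (by fun_prop)))
  choose y hyK hy using hmax
  have hle : ∀ x, ∀ y' ∈ K, u y' - k * dist x y' ≤ u (y x) - k * dist x (y x) := by
    intro x y' hy'
    have : u y' + (-(k * dist x y')) ≤ u (y x) + (-(k * dist x (y x))) := hy x hy'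
    linarith
  refine ⟨fun x => u (y x) - k * dist x (y x), LipschitzWith.of_le_add_mul k fun x x' => ?_,
    fun x => ⟨y x, hyK x, rfl⟩, hle⟩
  have h1 := hle x' (y x) (hyK x)
  have h2 : (k : ℝ) * dist x' (y x) ≤ k * (dist x x' + dist x (y x)) := by
    gcongr
    rw [dist_comm x x']
    exact dist_triangle _ _ _
  linarith

lemma leviForm_comp_add_add_const {E : Type*} [NormedAddCommGroup E] [NormedSpace ℂ E]
    (φ : E → ℝ) (a : E) (C : ℝ) (x ξ : E) :
    leviForm (fun y => φ (y + a) + C) x ξ = leviForm φ (x + a) ξ := by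
  have h1 : fderiv ℝ (fun y => φ (y + a) + C) = fun y => fderiv ℝ φ (y + a) := by
    ext1 y
    rw [fderiv_add_const, fderiv_comp_add_right]
  rw [leviForm, leviForm, h1, fderiv_comp_add_right (f := fderiv ℝ φ)]

/-- A test function for `g` at `x₀`, translated and shifted by a constant, is a test function for
`u` at `y₀`, with the same Levi form. -/
lemma HasLeviLowerBoundAt.of_translate {u g : EuclideanSpace ℂ (Fin n) → ℝ} {c C : ℝ}
    {x₀ y₀ : EuclideanSpace ℂ (Fin n)} (h : HasLeviLowerBoundAt c u y₀)
    (heq : u y₀ = g x₀ + C) (hle : ∀ᶠ y in 𝓝 y₀, u y ≤ g (y + (x₀ - y₀)) + C) :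
    HasLeviLowerBoundAt c g x₀ := by
  intro φ hφ ξ
  have hx : y₀ + (x₀ - y₀) = x₀ := by abel
  have htend : Filter.Tendsto (fun y => y + (x₀ - y₀)) (𝓝 y₀) (𝓝 x₀) := by
    have : Continuous fun y : EuclideanSpace ℂ (Fin n) => y + (x₀ - y₀) := by fun_prop
    simpa [hx] using this.tendsto y₀
  have := h (fun y => φ (y + (x₀ - y₀)) + C) ⟨?_, ?_, ?_⟩ ξ
  · rwa [leviForm_comp_add_add_const, hx] at this
  · refine ContDiffAt.add (ContDiffAt.comp y₀ ?_ (by fun_prop)) contDiffAt_const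
    rw [hx]; exact hφ.1
  · simp only [hx, heq, hφ.2.1]
  · filter_upwards [hle, htend.eventually hφ.2.2] with y h1 h2
    linarith

end SupConvolution

/-! ### Mollification and circle averages. -/

section Mollification

open Real MeasureTheory ContinuousLinearMap Convolution

variable {E : Type*} [NormedAddCommGroup E] [NormedSpace ℂ E]

lemma continuous_circleAverage_sub_add_smul {g : E → ℝ} (hg : Continuous g) (x ξ : E) (r : ℝ) :
    Continuous fun t => circleAverage (fun s => g (x - t + s • ξ)) 0 r := by
  have h : Continuous (Function.uncurry fun (t : E) (θ : ℝ) =>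
      g (x - t + circleMap 0 r θ • ξ)) := by
    simp only [Function.uncurry_def]
    fun_prop
  exact (intervalIntegral.continuous_parametric_intervalIntegral_of_continuous' (μ := volume)
    h 0 (2 * π)).const_smul (2 * π)⁻¹

variable [FiniteDimensional ℝ E] [MeasurableSpace E] [BorelSpace E] {μ : Measure E}
  [μ.IsAddHaarMeasure]

/-- Fubini; the compact support of the bump reduces integrability to a compact product. -/
lemma circleAverage_normed_convolution (φ : ContDiffBump (0 : E)) {g : E → ℝ}
    (hg : Continuous g) (x ξ : E) (r : ℝ) :
    circleAverage (fun s => (φ.normed μ ⋆[lsmul ℝ ℝ, μ] g) (x + s • ξ)) 0 r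
      = ∫ t, φ.normed μ t * circleAverage (fun s => g (x - t + s • ξ)) 0 r ∂μ := by
  have hφc : Continuous (φ.normed μ) := φ.continuous_normed
  have hcont : Continuous (Function.uncurry fun (θ : ℝ) (t : E) =>
      φ.normed μ t * g (x - t + circleMap 0 r θ • ξ)) := by
    simp only [Function.uncurry_def]
    fun_prop
  have hint : Integrable (Function.uncurry fun (θ : ℝ) (t : E) =>
      φ.normed μ t * g (x - t + circleMap 0 r θ • ξ))
      ((volume.restrict (Set.uIoc 0 (2 * π))).prod μ) := by
    have h1 : IntegrableOn (Function.uncurry fun (θ : ℝ) (t : E) =>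
        φ.normed μ t * g (x - t + circleMap 0 r θ • ξ))
        (Set.uIcc 0 (2 * π) ×ˢ tsupport (φ.normed μ)) (volume.prod μ) :=
      hcont.continuousOn.integrableOn_compact (isCompact_uIcc.prod φ.hasCompactSupport_normed)
    have h2 : IntegrableOn (Function.uncurry fun (θ : ℝ) (t : E) =>
        φ.normed μ t * g (x - t + circleMap 0 r θ • ξ))
        (Set.uIoc 0 (2 * π) ×ˢ Set.univ) (volume.prod μ) := by
      refine (h1.mono_set (Set.prod_mono_left Set.uIoc_subset_uIcc)).of_forall_sdiff_eq_zero
        (measurableSet_uIoc.prod MeasurableSet.univ) ?_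
      rintro ⟨θ, t⟩ ⟨⟨hθ, -⟩, ht⟩
      have ht' : t ∉ tsupport (φ.normed μ) := fun h => ht ⟨hθ, h⟩
      simp [image_eq_zero_of_notMem_tsupport ht']
    rw [IntegrableOn, ← Measure.prod_restrict, Measure.restrict_univ] at h2
    exact h2
  have hswap := intervalIntegral_integral_swap hint
  simp only [circleAverage_def, convolution_def, lsmul_apply, smul_eq_mul]
  have hsub : ∀ (θ : ℝ) (t : E), x + circleMap 0 r θ • ξ - t = x - t + circleMap 0 r θ • ξ := by
    intro θ t; abel
  simp only [hsub]
  rw [hswap, ← integral_const_mul]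
  refine integral_congr_ae (Filter.Eventually.of_forall fun t => ?_)
  simp only [intervalIntegral.integral_const_mul]
  ring

/-- Mollification preserves the sub-mean value inequality on discs. -/
lemma normed_convolution_add_le_circleAverage (φ : ContDiffBump (0 : E)) {g : E → ℝ}
    (hg : Continuous g) {x ξ : E} {r κ : ℝ}
    (h : ∀ t ∈ Metric.ball (0 : E) φ.rOut,
      g (x - t) + κ ≤ circleAverage (fun s => g (x - t + s • ξ)) 0 r) :
    (φ.normed μ ⋆[lsmul ℝ ℝ, μ] g) x + κ
      ≤ circleAverage (fun s => (φ.normed μ ⋆[lsmul ℝ ℝ, μ] g) (x + s • ξ)) 0 r := by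
  rw [circleAverage_normed_convolution φ hg, convolution_def]
  have hφc : Continuous (φ.normed μ) := φ.continuous_normed
  have hint : ∀ F : E → ℝ, Continuous F → Integrable (fun t => φ.normed μ t * F t) μ :=
    fun F hF => (hφc.mul hF).integrable_of_hasCompactSupport φ.hasCompactSupport_normed.mul_right
  have hκ : κ = ∫ t, φ.normed μ t * κ ∂μ := by
    rw [integral_mul_const, φ.integral_normed, one_mul]
  simp only [lsmul_apply, smul_eq_mul]
  conv_lhs => rw [hκ]
  rw [← integral_add (hint (fun t => g (x - t)) (by fun_prop)) (hint _ continuous_const)]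
  refine integral_mono ((hint (fun t => g (x - t)) (by fun_prop)).add (hint _ continuous_const))
    (hint _ (continuous_circleAverage_sub_add_smul hg x ξ r)) fun t => ?_
  by_cases ht : t ∈ Metric.ball (0 : E) φ.rOut
  · have := mul_le_mul_of_nonneg_left (h t ht) (φ.nonneg_normed (μ := μ) t)
    simpa [mul_add] using this
  · have : φ.normed μ t = 0 := by
      rw [← φ.support_normed_eq (μ := μ)] at ht
      simpa using ht
    simp [this]

end Mollification

/-! ### Smooth approximation of subsolutions. -/

section SmoothApproximation

open Real MeasureTheory ContinuousLinearMap Convolution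

variable {n : ℕ}

/-- Lipschitz viscosity subsolutions are uniform limits of smooth subsolutions. -/
theorem exists_contDiff_approx_of_lipschitz {g : EuclideanSpace ℂ (Fin n) → ℝ} {L : NNReal}
    (hg : LipschitzWith L g) {c R ρ : ℝ} {z₀ : EuclideanSpace ℂ (Fin n)} (hρR : ρ < R)
    (hsub : ∀ x ∈ Metric.ball z₀ R, HasLeviLowerBoundAt c g x) {η : ℝ} (hη : 0 < η) :
    ∃ w : EuclideanSpace ℂ (Fin n) → ℝ, ContDiff ℝ 2 w ∧ (∀ x, |w x - g x| ≤ η) ∧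
      ∀ x ∈ Metric.closedBall z₀ ρ, ∀ ξ, c * ‖ξ‖ ^ 2 ≤ leviForm w x ξ := by
  -- Half of the gap is spent on the mollification radius, half on the discs.
  set d := (R - ρ) / 2 with hd
  have hd0 : 0 < d := by rw [hd]; linarith
  set ε := min (η / (L + 1)) d with hε
  have hε0 : 0 < ε := lt_min (by positivity) hd0
  have hεd : ε ≤ d := min_le_right _ _
  have hεL : L * ε ≤ η := by
    calc (L : ℝ) * ε ≤ (L + 1) * (η / (L + 1)) := by
          gcongr
          · linarith
          · exact min_le_left _ _
      _ = η := by field_simp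
  let φ : ContDiffBump (0 : EuclideanSpace ℂ (Fin n)) := ⟨ε / 2, ε, half_pos hε0, half_lt_self hε0⟩
  let μ : Measure (EuclideanSpace ℂ (Fin n)) := Measure.addHaar
  set w := φ.normed μ ⋆[lsmul ℝ ℝ, μ] g with hw
  have hwc : ContDiff ℝ 2 w := φ.hasCompactSupport_normed.contDiff_convolution_left _
    φ.contDiff_normed hg.continuous.locallyIntegrable
  refine ⟨w, hwc, fun x => ?_, fun x hx ξ => ?_⟩
  · rw [← Real.dist_eq]
    refine φ.dist_normed_convolution_le hg.continuous.aestronglyMeasurable fun y hy => ?_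
    refine (hg.dist_le_mul y x).trans (le_trans ?_ hεL)
    gcongr
    exact (Metric.mem_ball.1 hy).le
  · refine le_leviForm_of_eventually_le_circleAverage hwc.contDiffAt ?_
    filter_upwards [Ioo_mem_nhdsGT (show 0 < d / (‖ξ‖ + 1) by positivity)] with r hr
    have hnorm : ‖(r : ℂ) • ξ‖ = r * ‖ξ‖ := by
      rw [norm_smul, Complex.norm_real, Real.norm_of_nonneg hr.1.le]
    have hrd : r * ‖ξ‖ < d := by
      have h1 := (lt_div_iff₀ (by positivity)).1 hr.2
      have h2 := hr.1
      nlinarith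
    have hscale : ∀ F : EuclideanSpace ℂ (Fin n) → ℝ, ∀ y,
        circleAverage (fun s => F (y + s • ξ)) 0 r
          = circleAverage (fun s => F (y + s • (r : ℂ) • ξ)) 0 1 := by
      intro F y
      rw [circleAverage_eq_circleAverage_zero_one]
      simp only [add_zero, smul_smul, mul_comm]
    rw [hscale]
    have := normed_convolution_add_le_circleAverage (μ := μ) φ hg.continuous (x := x)
      (ξ := (r : ℂ) • ξ) (r := 1) (κ := c * ‖(r : ℂ) • ξ‖ ^ 2) fun t ht => by
        refine HasLeviLowerBoundAt.add_le_circleAverage hg (R := d) (fun y hy => hsub y ?_)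
          (hnorm.trans_lt hrd)
        rw [Metric.mem_ball, dist_eq_norm] at hy ⊢
        rw [Metric.mem_closedBall, dist_eq_norm] at hx
        have ht' : ‖t‖ < ε := by simpa using ht
        calc ‖y - z₀‖ = ‖(y - (x - t)) + (x - z₀) - t‖ := by congr 1; abel
          _ ≤ ‖y - (x - t)‖ + ‖x - z₀‖ + ‖t‖ :=
            (norm_sub_le _ _).trans (by gcongr; exact norm_add_le _ _)
          _ < d + ρ + d := by linarith
          _ = R := by rw [hd]; ring
    rw [hnorm] at this
    convert this using 2
    ring

/-- Bounded viscosity subsolutions are approximated by smooth subsolutions: the approximations are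
almost as large at the center, and almost dominated by nearby values. -/
theorem exists_contDiff_approx {u : EuclideanSpace ℂ (Fin n) → ℝ}
    {z₀ : EuclideanSpace ℂ (Fin n)} {ρ c M : ℝ} (hρ : 0 < ρ)
    (hu : UpperSemicontinuousOn u (Metric.closedBall z₀ (2 * ρ)))
    (hM : ∀ x ∈ Metric.closedBall z₀ (2 * ρ), |u x| ≤ M)
    (hsub : ∀ x ∈ Metric.ball z₀ (2 * ρ), HasLeviLowerBoundAt c u x)
    {r η : ℝ} (hr : 0 < r) (hη : 0 < η) :
    ∃ w : EuclideanSpace ℂ (Fin n) → ℝ, ContDiff ℝ 2 w ∧ u z₀ - η ≤ w z₀ ∧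
      (∀ x ∈ Metric.closedBall z₀ ρ, ∃ y, dist y x ≤ r ∧ w x ≤ u y + η) ∧
      ∀ x ∈ Metric.closedBall z₀ ρ, ∀ ξ, c * ‖ξ‖ ^ 2 ≤ leviForm w x ξ := by
  have hz₀ : z₀ ∈ Metric.closedBall z₀ (2 * ρ) := Metric.mem_closedBall_self (by positivity)
  have hM0 : 0 ≤ M := (abs_nonneg _).trans (hM z₀ hz₀)
  set d := min r (ρ / 4) with hd
  have hd0 : 0 < d := lt_min hr (by positivity)
  -- The slope exceeds `2 * M / d`, so a maximizer farther than `d` would lose more than the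
  -- oscillation of `u` can return.
  let k : NNReal := ⟨2 * M / d + 1, by positivity⟩
  have hk : (k : ℝ) = 2 * M / d + 1 := rfl
  obtain ⟨g, hgL, hgy, hgle⟩ := exists_supConvolution (isCompact_closedBall z₀ (2 * ρ))
    ⟨z₀, hz₀⟩ hu k
  have hnear : ∀ x ∈ Metric.closedBall z₀ (2 * ρ), ∀ y ∈ Metric.closedBall z₀ (2 * ρ),
      g x = u y - k * dist x y → dist x y ≤ d := by
    intro x hx y hy hxy
    have h1 := hgle x x hx
    rw [dist_self, mul_zero, sub_zero, hxy] at h1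
    have h2 := (abs_le.1 (hM x hx)).1
    have h3 := (abs_le.1 (hM y hy)).2
    have h4 : (k : ℝ) * dist x y ≤ 2 * M := by linarith
    by_contra! hlt
    have h5 : (k : ℝ) * d < k * dist x y := by
      have : 0 < (k : ℝ) := by rw [hk]; positivity
      gcongr
    have h6 : (k : ℝ) * d = 2 * M + d := by rw [hk]; field_simp
    linarith
  -- Since `d ≤ ρ / 4`, maximizers for these `x` stay in the open ball where the bound on `u` is
  -- available.
  have hgsub : ∀ x ∈ Metric.ball z₀ (3 / 2 * ρ), HasLeviLowerBoundAt c g x := by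
    intro x hx
    obtain ⟨y, hy, hxy⟩ := hgy x
    rw [Metric.mem_ball] at hx
    have hxd := hnear x (Metric.mem_closedBall.2 (by linarith)) y hy hxy
    have hyb : y ∈ Metric.ball z₀ (2 * ρ) := by
      rw [Metric.mem_ball]
      have h1 := dist_triangle_left y z₀ x
      have h2 : d ≤ ρ / 4 := min_le_right _ _
      linarith
    refine (hsub y hyb).of_translate (C := k * dist x y) (by rw [hxy]; ring) ?_
    filter_upwards [Metric.isOpen_ball.mem_nhds hyb] with y' hy'
    have := hgle (y' + (x - y)) y' (Metric.ball_subset_closedBall hy')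
    rw [show dist (y' + (x - y)) y' = dist x y by
      rw [dist_eq_norm, dist_eq_norm]; congr 1; abel] at this
    linarith
  obtain ⟨w, hwc, hwg, hwl⟩ := exists_contDiff_approx_of_lipschitz hgL
    (show ρ < 3 / 2 * ρ by linarith) hgsub hη
  refine ⟨w, hwc, ?_, fun x hx => ?_, hwl⟩
  · have h1 := hgle z₀ z₀ hz₀
    rw [dist_self, mul_zero, sub_zero] at h1
    have h2 := (abs_le.1 (hwg z₀)).1
    linarith
  · obtain ⟨y, hy, hxy⟩ := hgy x
    have hx2 : x ∈ Metric.closedBall z₀ (2 * ρ) :=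
      Metric.closedBall_subset_closedBall (by linarith) hx
    refine ⟨y, ?_, ?_⟩
    · rw [dist_comm]
      exact (hnear x hx2 y hy hxy).trans (min_le_left _ _)
    · have h1 := (abs_le.1 (hwg x)).2
      have h2 : 0 ≤ (k : ℝ) * dist x y := by positivity
      linarith

end SmoothApproximation

/-! ### Levi forms of sums and of quadratic functions. -/

section LeviFormCalculus

variable {E : Type*} [NormedAddCommGroup E]

lemma leviForm_add [NormedSpace ℂ E] {φ ψ : E → ℝ} {z : E} (hφ : ContDiffAt ℝ 2 φ z)
    (hψ : ContDiffAt ℝ 2 ψ z) (ξ : E) :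
    leviForm (fun x => φ x + ψ x) z ξ = leviForm φ z ξ + leviForm ψ z ξ := by
  have h1 : fderiv ℝ (fun x => φ x + ψ x) =ᶠ[𝓝 z] fun x => fderiv ℝ φ x + fderiv ℝ ψ x := by
    filter_upwards [hφ.eventually_differentiableAt_two, hψ.eventually_differentiableAt_two]
      with x hx hx'
    exact fderiv_fun_add hx hx'
  have h2 := fderiv_fun_add hφ.differentiableAt_fderiv_two hψ.differentiableAt_fderiv_two
  rw [leviForm, h1.fderiv_eq, h2]
  simp only [leviForm, add_apply]
  ring

variable [InnerProductSpace ℂ E]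

lemma norm_add_smul_sq_eq_re (x ξ : E) (s : ℂ) :
    ‖x + s • ξ‖ ^ 2 = (((‖x‖ ^ 2 : ℝ) : ℂ) + 2 * inner ℂ x ξ * s).re + ‖ξ‖ ^ 2 * ‖s‖ ^ 2 := by
  rw [norm_add_sq (𝕜 := ℂ), inner_smul_right, norm_smul, RCLike.re_eq_complex_re,
    Complex.add_re, Complex.ofReal_re]
  have : (2 * inner ℂ x ξ * s).re = 2 * (s * inner ℂ x ξ).re := by
    rw [mul_assoc, mul_comm s]; simp
  rw [this]
  ring

lemma leviForm_mul_norm_sq_sub_mul_norm_sub_sq (a b : ℝ) (z₀ x ξ : E) :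
    leviForm (fun x => a * ‖x‖ ^ 2 - b * ‖x - z₀‖ ^ 2) x ξ = (a - b) * ‖ξ‖ ^ 2 := by
  have h1 : ContDiff ℝ 2 fun x : E => ‖x‖ ^ 2 := contDiff_norm_sq ℂ
  have h2 : ContDiff ℝ 2 fun x : E => ‖x - z₀‖ ^ 2 :=
    h1.comp (g := fun x : E => ‖x‖ ^ 2) (f := fun x => x - z₀) (by fun_prop)
  refine leviForm_eq_of_eq_re_add
    (((contDiff_const.mul h1).sub (contDiff_const.mul h2)).contDiffAt)
    (P := fun s => (a : ℂ) * (((‖x‖ ^ 2 : ℝ) : ℂ) + 2 * inner ℂ x ξ * s)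
      - (b : ℂ) * (((‖x - z₀‖ ^ 2 : ℝ) : ℂ) + 2 * inner ℂ (x - z₀) ξ * s)) (by fun_prop)
    fun s => ?_
  rw [show x + s • ξ - z₀ = (x - z₀) + s • ξ by abel, norm_add_smul_sq_eq_re,
    norm_add_smul_sq_eq_re, Complex.sub_re, Complex.re_ofReal_mul, Complex.re_ofReal_mul]
  ring

end LeviFormCalculus

/-! ### The comparison argument. -/

section Comparison

variable {n : ℕ}

lemma IsViscositySubsolution.hasLeviLowerBoundAt (hn : 1 ≤ n)
    {Ω : Set (EuclideanSpace ℂ (Fin n))} {f u : EuclideanSpace ℂ (Fin n) → ℝ}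
    (hu : IsViscositySubsolution Ω f u) {z : EuclideanSpace ℂ (Fin n)} (hz : z ∈ Ω) {c : ℝ}
    (hc : c ≤ f z) : HasLeviLowerBoundAt c u z := fun φ hφ =>
  (le_firstEigenvalue_complexHessian_iff hn hφ.1 c).1
    (hc.trans (hu.le_firstEigenvalue z hz φ hφ))

lemma IsViscositySupersolution.le_of_touchesFromBelow (hn : 1 ≤ n)
    {Ω : Set (EuclideanSpace ℂ (Fin n))} {f v : EuclideanSpace ℂ (Fin n) → ℝ}
    (hv : IsViscositySupersolution Ω f v) {z : EuclideanSpace ℂ (Fin n)} (hz : z ∈ Ω)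
    {ψ : EuclideanSpace ℂ (Fin n) → ℝ} (hψ : TouchesFromBelow ψ v z) {c : ℝ}
    (hc : ∀ ξ, c * ‖ξ‖ ^ 2 ≤ leviForm ψ z ξ) : c ≤ f z :=
  ((le_firstEigenvalue_complexHessian_iff hn hψ.1 c).2 hc).trans
    ((le_max_left _ _).trans (hv.firstEigenvalue_le z hz ψ hψ))

/-- If `u - v + q` has a strict maximum over a closed ball at its center, `q` being quadratic with
Levi form `(a - b) ‖ξ‖²`, then `u` cannot be a subsolution and `v` a supersolution with right-hand
sides that differ by less than `a - b`. -/
lemma exists_mem_ball_le_of_isMaxOn {u v : EuclideanSpace ℂ (Fin n) → ℝ} {a b c M ρ : ℝ}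
    {z₀ : EuclideanSpace ℂ (Fin n)} (hb : 0 < b) (hρ : 0 < ρ)
    (hu : ∀ x ∈ Metric.closedBall z₀ (2 * ρ), UpperSemicontinuousAt u x)
    (hv : ∀ x ∈ Metric.closedBall z₀ (2 * ρ), LowerSemicontinuousAt v x)
    (hM : ∀ x ∈ Metric.closedBall z₀ (2 * ρ), |u x| ≤ M)
    (hsub : ∀ x ∈ Metric.ball z₀ (2 * ρ), HasLeviLowerBoundAt c u x)
    (hmax : ∀ x ∈ Metric.closedBall z₀ (2 * ρ),
      u x - v x + a * ‖x‖ ^ 2 ≤ u z₀ - v z₀ + a * ‖z₀‖ ^ 2) :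
    ∃ x ∈ Metric.ball z₀ (2 * ρ), ∃ ψ, TouchesFromBelow ψ v x ∧
      ∀ ξ, (c + (a - b)) * ‖ξ‖ ^ 2 ≤ leviForm ψ x ξ := by
  let q : EuclideanSpace ℂ (Fin n) → ℝ := fun x => a * ‖x‖ ^ 2 - b * ‖x - z₀‖ ^ 2
  have hqc : Continuous q := by fun_prop
  have hq : ContDiff ℝ 2 q := by
    have h1 : ContDiff ℝ 2 fun x : EuclideanSpace ℂ (Fin n) => ‖x‖ ^ 2 := contDiff_norm_sq ℂ
    have h2 : ContDiff ℝ 2 fun x : EuclideanSpace ℂ (Fin n) => ‖x - z₀‖ ^ 2 :=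
      h1.comp (g := fun x : EuclideanSpace ℂ (Fin n) => ‖x‖ ^ 2) (f := fun x => x - z₀)
        (by fun_prop)
    exact (contDiff_const.mul h1).sub (contDiff_const.mul h2)
  set m := u z₀ - v z₀ + q z₀ with hm
  have hqz₀ : q z₀ = a * ‖z₀‖ ^ 2 := by simp [q]
  set η := b * ρ ^ 2 / 4 with hη
  have hη0 : 0 < η := by positivity
  have hsubset : Metric.closedBall z₀ ρ ⊆ Metric.closedBall z₀ (2 * ρ) :=
    Metric.closedBall_subset_closedBall (by linarith)
  -- On the sphere the term in `b` costs `b * ρ ^ 2 = 4 * η`. Semicontinuity and compactness retain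
  -- `2 * η` of it when `u` is read at a nearby point, which is needed because `w` is dominated only
  -- by nearby values of `u`.
  have hsphere : ∀ᶠ h in 𝓝 (0 : EuclideanSpace ℂ (Fin n)), ∀ x ∈ Metric.sphere z₀ ρ,
      u (x + h) - v x + q x < m - 2 * η := by
    refine (isCompact_sphere z₀ ρ).eventually_forall_of_forall_eventually fun x hx => ?_
    have hx2 := hsubset (Metric.sphere_subset_closedBall hx)
    have hval : u x - v x + q x ≤ m - 4 * η := by
      have h1 := hmax x hx2
      have h2 : ‖x - z₀‖ = ρ := by rw [← dist_eq_norm]; exact hx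
      rw [hm, hqz₀]
      simp only [q, h2]
      linarith
    have hadd : Filter.Tendsto
        (fun p : EuclideanSpace ℂ (Fin n) × EuclideanSpace ℂ (Fin n) => p.2 + p.1)
        (𝓝 (0, x)) (𝓝 x) := by
      have : Continuous fun p : EuclideanSpace ℂ (Fin n) × EuclideanSpace ℂ (Fin n) =>
        p.2 + p.1 := by fun_prop
      simpa using this.tendsto (0, x)
    have hsnd : Filter.Tendsto
        (fun p : EuclideanSpace ℂ (Fin n) × EuclideanSpace ℂ (Fin n) => p.2)
        (𝓝 (0, x)) (𝓝 x) := continuous_snd.tendsto (0, x)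
    have e1 := hadd.eventually (hu x hx2 (u x + η / 2) (by linarith))
    have e2 := hsnd.eventually (hv x hx2 (v x - η / 2) (by linarith))
    have e3 := hsnd.eventually (hqc.continuousAt.eventually_lt (continuousAt_const (y := q x + η))
      (by linarith))
    filter_upwards [e1, e2, e3] with p h1 h2 h3
    linarith
  obtain ⟨r, hr, hsphere⟩ := Metric.nhds_basis_closedBall.eventually_iff.1 hsphere
  obtain ⟨w, hwc, hwz₀, hwu, hwl⟩ := exists_contDiff_approx hρ
    (fun x hx => (hu x hx).upperSemicontinuousWithinAt _) hM hsub hr hη0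
  have husc : UpperSemicontinuousOn (fun x => (w x + q x) + (-v) x) (Metric.closedBall z₀ ρ) :=
    (hwc.continuous.add hqc).continuousOn.upperSemicontinuousOn.add
      (LowerSemicontinuousOn.neg fun x hx => (hv x (hsubset hx)).lowerSemicontinuousWithinAt _)
  have hz₀ : z₀ ∈ Metric.closedBall z₀ ρ := Metric.mem_closedBall_self hρ.le
  obtain ⟨x₁, hx₁, hx₁max⟩ := husc.exists_isMaxOn ⟨z₀, hz₀⟩ (isCompact_closedBall z₀ ρ)
  have hle : ∀ x ∈ Metric.closedBall z₀ ρ, w x + q x - v x ≤ w x₁ + q x₁ - v x₁ := by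
    intro x hx
    have : (w x + q x) + (-v) x ≤ (w x₁ + q x₁) + (-v) x₁ := hx₁max hx
    simpa only [Pi.neg_apply, ← sub_eq_add_neg] using this
  -- On the sphere `w + q - v < m - η`, while at the center it is at least `m - η`.
  have hx₁ball : x₁ ∈ Metric.ball z₀ ρ := by
    refine lt_of_le_of_ne (Metric.mem_closedBall.1 hx₁) fun heq => ?_
    obtain ⟨y, hyd, hwy⟩ := hwu x₁ hx₁
    have h1 := hsphere (x := y - x₁) (by simpa [← dist_eq_norm] using hyd) x₁ heq
    rw [add_sub_cancel] at h1
    have h2 := hle z₀ hz₀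
    linarith
  refine ⟨x₁, Metric.ball_subset_ball (by linarith) hx₁ball,
    fun x => (w x + q x) + (v x₁ - (w x₁ + q x₁)), ⟨?_, ?_, ?_⟩, fun ξ => ?_⟩
  · exact ((hwc.add hq).add contDiff_const).contDiffAt
  · ring
  · filter_upwards [Metric.isOpen_ball.mem_nhds hx₁ball] with x hx
    have := hle x (Metric.ball_subset_closedBall hx)
    linarith
  · have h1 := leviForm_comp_add_add_const (fun x => w x + q x) 0 (v x₁ - (w x₁ + q x₁)) x₁ ξ
    simp only [add_zero] at h1
    rw [h1, leviForm_add hwc.contDiffAt hq.contDiffAt,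
      leviForm_mul_norm_sq_sub_mul_norm_sub_sq, add_mul]
    gcongr
    exact hwl x₁ hx₁ ξ

end Comparison

theorem theoremA {n : ℕ} (hn : 1 ≤ n) (Ω : Set (EuclideanSpace ℂ (Fin n)))
    (hΩ_open : IsOpen Ω) (hΩ_bdd : Bornology.IsBounded Ω)
    (f : EuclideanSpace ℂ (Fin n) → ℝ)
    (hf_cont : ContinuousOn f Ω) (hf_pos : ∀ z ∈ Ω, 0 < f z)
    (u v : EuclideanSpace ℂ (Fin n) → ℝ)
    (hu_usc : UpperSemicontinuousOn u (closure Ω)) (hv_lsc : LowerSemicontinuousOn v (closure Ω))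
    (hu_bdd : ∃ C : ℝ, ∀ z ∈ Ω, |u z| ≤ C) (hv_bdd : ∃ C : ℝ, ∀ z ∈ Ω, |v z| ≤ C)
    (hu : IsViscositySubsolution Ω f u) (hv : IsViscositySupersolution Ω f v)
    (huv : ∀ z ∈ frontier Ω, u z ≤ v z) :
    ∀ z ∈ Ω, u z ≤ v z := by
  by_contra! hcon
  obtain ⟨z', hz'Ω, hz'⟩ := hcon
  obtain ⟨R, hR⟩ := hΩ_bdd.closure.exists_norm_le
  obtain ⟨C, hC⟩ := hu_bdd
  -- So small that the quadratic term cannot move the maximum to the boundary, where `u - v ≤ 0`.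
  obtain ⟨a, ha, haR⟩ : ∃ a > 0, a * R ^ 2 < u z' - v z' := by
    refine ⟨(u z' - v z') / (R ^ 2 + 1), div_pos (by linarith) (by positivity), ?_⟩
    rw [div_mul_eq_mul_div, div_lt_iff₀ (by positivity)]
    nlinarith
  have husc : UpperSemicontinuousOn (fun x => (u x + (-v) x) + a * ‖x‖ ^ 2) (closure Ω) :=
    (hu_usc.add hv_lsc.neg).add (ContinuousOn.upperSemicontinuousOn (by fun_prop))
  obtain ⟨z₀, hz₀, hz₀max⟩ := husc.exists_isMaxOn ⟨z', subset_closure hz'Ω⟩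
    hΩ_bdd.isCompact_closure
  have hmax : ∀ x ∈ closure Ω, u x - v x + a * ‖x‖ ^ 2 ≤ u z₀ - v z₀ + a * ‖z₀‖ ^ 2 := by
    intro x hx
    have : (u x + (-v) x) + a * ‖x‖ ^ 2 ≤ (u z₀ + (-v) z₀) + a * ‖z₀‖ ^ 2 := hz₀max hx
    simpa only [Pi.neg_apply, ← sub_eq_add_neg] using this
  have hz₀Ω : z₀ ∈ Ω := by
    by_contra hnot
    have h1 := huv z₀ (by rw [hΩ_open.frontier_eq]; exact ⟨hz₀, hnot⟩)
    have h2 := hmax z' (subset_closure hz'Ω)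
    have h3 : a * ‖z₀‖ ^ 2 ≤ a * R ^ 2 := by
      have := hR z₀ hz₀
      gcongr
    have h4 : 0 ≤ a * ‖z'‖ ^ 2 := by positivity
    linarith
  have hnear : ∀ᶠ x in 𝓝 z₀, x ∈ Ω ∧ |f x - f z₀| < a / 8 := by
    refine (hΩ_open.eventually_mem hz₀Ω).and ?_
    have := Metric.tendsto_nhds.1 (hf_cont.continuousAt (hΩ_open.mem_nhds hz₀Ω)) (a / 8)
      (by positivity)
    simpa only [Real.dist_eq] using this
  obtain ⟨δ, hδ, hball⟩ := Metric.nhds_basis_closedBall.eventually_iff.1 hnear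
  have hδ2 : 2 * (δ / 2) = δ := by ring
  -- These constants give `c + (a - b) = f z₀ + 3 * a / 8`, whereas `f x < f z₀ + a / 8` in the
  -- ball.
  obtain ⟨x, hx, ψ, hψ, hψl⟩ := exists_mem_ball_le_of_isMaxOn (u := u) (v := v) (a := a)
    (b := a / 2) (c := f z₀ - a / 8) (M := C) (ρ := δ / 2) (z₀ := z₀) (by positivity)
    (by positivity)
    (fun x hx => by
      rw [hδ2] at hx
      intro y hy
      rw [← hΩ_open.nhdsWithin_eq (hball hx).1]
      exact hu.upperSemicontinuousOn x (hball hx).1 y hy)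
    (fun x hx => by
      rw [hδ2] at hx
      intro y hy
      rw [← hΩ_open.nhdsWithin_eq (hball hx).1]
      exact hv.lowerSemicontinuousOn x (hball hx).1 y hy)
    (fun x hx => by
      rw [hδ2] at hx
      exact hC x (hball hx).1)
    (fun x hx => by
      rw [hδ2] at hx
      have := hball (Metric.ball_subset_closedBall hx)
      have h2 := (abs_lt.1 this.2).1
      exact hu.hasLeviLowerBoundAt hn this.1 (by linarith))
    (fun x hx => by
      rw [hδ2] at hx
      exact hmax x (subset_closure (hball hx).1))
  rw [hδ2] at hx
  have hxΩ := hball (Metric.ball_subset_closedBall hx)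
  have h1 := hv.le_of_touchesFromBelow hn hxΩ.1 hψ hψl
  have h2 := (abs_lt.1 hxΩ.2).2
  linarith
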